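/- Let $\mathscr{E}=\{\eta_i,\rho_i\}_{i=1}^{n}$ be an ensemble of two-qubit states (density operators on $\mathbb{C}^2\otimes\mathbb{C}^2$) with probabilities $\eta_i>0$, $\sum_i\eta_i=1$, let $\rho_0=\sum_{i=1}^n\eta_i\rho_i$, and let $j\in\{1,\ldots,n\}$. For a measurement $\mathscr{M}=\{M_i\}_{i=0}^{n}$ (that is, $M_i\geqslant 0$ and $\sum_{i=0}^n M_i=\mathbb{1}$) with $\mathrm{Tr}(\rho_0M_j)\neq0$, the confidence to identify $\rho_j$ is $\Pr(\rho_j|M_j)=\eta_j\mathrm{Tr}(\rho_jM_j)/\mathrm{Tr}(\rho_0M_j)$. Let $\mathcal{C}_j(\mathscr{E})$ and $\mathcal{L}_j(\mathscr{E})$ be the suprema of $\Pr(\rho_j|M_j)$ over all measurements and over all measurements realizable by (finite-round) local operations and classical communication (LOCC), respectively, with $\mathrm{Tr}(\rho_0M_j)\neq0$. Let $\mathbb{SEP}$ be the cone of all finite sums $\sum_l p_l\,\sigma_l\otimes\tau_l$ with $p_l\geqslant0$ and one-qubit states $\sigma_l,\tau_l$; a Hermitian operator $W$ is block positive if $\mathrm{Tr}(WF)\geqslant0$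 for all $F\in\mathbb{SEP}$. Let $\mathcal{Q}_j(\mathscr{E})$ be the least real $q$ for which $q\rho_0-\eta_j\rho_j$ is block positive. An entanglement witness is a block-positive operator $W$ with $\mathrm{Tr}(WF)<0$ for some positive-semidefinite $F\notin\mathbb{SEP}$; it is weakly optimal if $\mathrm{Tr}(\sigma W)=0$ for some separable state $\sigma$ (a $\sigma\in\mathbb{SEP}$ with $\mathrm{Tr}\,\sigma=1$). Then, for every $q\in\mathbb{R}$, $\mathcal{Q}_j(\mathscr{E})=q<\mathcal{C}_j(\mathscr{E})$ if and only if $q\rho_0-\eta_j\rho_j$ is a weakly optimal entanglement witness. Moreover, if $\rho_0$ is not of full rank, then the maximum confidence is achievable locally, that is, $\mathcal{L}_j(\mathscr{E})=\mathcal{C}_j(\mathscr{E})$. -/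

import Mathlib

open scoped Kronecker ComplexOrder

namespace Confidence

/-- Operators on the bipartite Hilbert space `ℂ^d₁ ⊗ ℂ^d₂`, in the product basis. -/
abbrev BOp (d₁ d₂ : ℕ) : Type := Matrix (Fin d₁ × Fin d₂) (Fin d₁ × Fin d₂) ℂ

/-- A quantum state (density operator): positive semidefinite with trace one. -/
def IsState {κ : Type} [Fintype κ] (ρ : Matrix κ κ ℂ) : Prop :=
  ρ.PosSemidef ∧ ρ.trace = 1

/-- The cone `SEP` of separable operators: finite conic combinations of product states. -/
def SEP (d₁ d₂ : ℕ) : Set (BOp d₁ d₂) :=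
  {E | ∃ (K : ℕ) (p : Fin K → ℝ) (σ : Fin K → Matrix (Fin d₁) (Fin d₁) ℂ)
      (τ : Fin K → Matrix (Fin d₂) (Fin d₂) ℂ),
      (∀ l, 0 ≤ p l) ∧ (∀ l, IsState (σ l)) ∧ (∀ l, IsState (τ l)) ∧
      E = ∑ l, p l • (σ l ⊗ₖ τ l)}

/-- The dual cone `SEP*` of block-positive Hermitian operators. -/
def BlockPositive (d₁ d₂ : ℕ) : Set (BOp d₁ d₂) :=
  {W | W.IsHermitian ∧ ∀ F ∈ SEP d₁ d₂, 0 ≤ (W * F).trace.re}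

/-- Entanglement witness: nonnegative expectation on all separable operators, negative on some
positive-semidefinite operator that is not separable. -/
def IsEW {d₁ d₂ : ℕ} (W : BOp d₁ d₂) : Prop :=
  W.IsHermitian ∧ (∀ F ∈ SEP d₁ d₂, 0 ≤ (W * F).trace.re) ∧
    ∃ F : BOp d₁ d₂, F.PosSemidef ∧ F ∉ SEP d₁ d₂ ∧ (W * F).trace.re < 0

/-- Weakly optimal entanglement witness: its expectation vanishes on some separable state. -/
def IsWeaklyOptimalEW {d₁ d₂ : ℕ} (W : BOp d₁ d₂) : Prop :=
  IsEW W ∧ ∃ σ : BOp d₁ d₂, σ ∈ SEP d₁ d₂ ∧ IsState σ ∧ (σ * W).trace = 0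

/-- A measurement (POVM) with outcomes in `ι`. -/
def IsMeasurement {ι : Type} [Fintype ι] {d₁ d₂ : ℕ} (M : ι → BOp d₁ d₂) : Prop :=
  (∀ i, (M i).PosSemidef) ∧ ∑ i, M i = 1

/-- Families of effects that are realized by a finite-round LOCC protocol, given by recursion on
the protocol tree (in the Heisenberg picture). Either the parties stop and announce a fixed
outcome `i`; or one of the parties performs a local measurement with Kraus operators
`A 0, …, A (K - 1)` (the local dimension after the measurement may change, and may depend on the
result, so that local ancillas are included), broadcasts the result `k`, and the parties go on with
an LOCC protocol that depends on `k`. Shared randomness is the case where the Kraus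
operators are multiples of the identity. -/
inductive IsLOCC {ι : Type} [DecidableEq ι] :
    (d₁ d₂ : ℕ) → (ι → BOp d₁ d₂) → Prop
  | announce (d₁ d₂ : ℕ) (i : ι) : IsLOCC d₁ d₂ (fun i' => if i' = i then 1 else 0)
  | first (d₁ d₂ K : ℕ) (d : Fin K → ℕ) (A : (k : Fin K) → Matrix (Fin (d k)) (Fin d₁) ℂ)
      (hA : ∑ k, (A k).conjTranspose * A k = 1)
      (N : (k : Fin K) → ι → BOp (d k) d₂) (hN : ∀ k, IsLOCC (d k) d₂ (N k)) :
      IsLOCC d₁ d₂ (fun i => ∑ k,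
        (A k ⊗ₖ (1 : Matrix (Fin d₂) (Fin d₂) ℂ)).conjTranspose * N k i *
          (A k ⊗ₖ (1 : Matrix (Fin d₂) (Fin d₂) ℂ)))
  | second (d₁ d₂ K : ℕ) (d : Fin K → ℕ) (B : (k : Fin K) → Matrix (Fin (d k)) (Fin d₂) ℂ)
      (hB : ∑ k, (B k).conjTranspose * B k = 1)
      (N : (k : Fin K) → ι → BOp d₁ (d k)) (hN : ∀ k, IsLOCC d₁ (d k) (N k)) :
      IsLOCC d₁ d₂ (fun i => ∑ k,
        ((1 : Matrix (Fin d₁) (Fin d₁) ℂ) ⊗ₖ B k).conjTranspose * N k i *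
          ((1 : Matrix (Fin d₁) (Fin d₁) ℂ) ⊗ₖ B k))

/-- An LOCC measurement: a measurement that is realized by an LOCC protocol. -/
def IsLOCCMeasurement {ι : Type} [Fintype ι] [DecidableEq ι] {d₁ d₂ : ℕ}
    (M : ι → BOp d₁ d₂) : Prop :=
  IsMeasurement M ∧ IsLOCC d₁ d₂ M

/-- An ensemble of `n` bipartite states with nonzero prior probabilities. -/
structure Ensemble (n d₁ d₂ : ℕ) where
  η : Fin n → ℝ
  ρ : Fin n → BOp d₁ d₂
  η_pos : ∀ i, 0 < η i
  η_sum : ∑ i, η i = 1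
  isState : ∀ i, IsState (ρ i)

namespace Ensemble

variable {n d₁ d₂ : ℕ}

/-- The average state `ρ₀ = ∑ i, η i • ρ i`. -/
noncomputable def avg (E : Ensemble n d₁ d₂) : BOp d₁ d₂ := ∑ i, E.η i • E.ρ i

/-- Confidence of the measurement `M` to identify the state `j`. Outcome `0` of `M` is the
inconclusive one; outcome `j.succ` is the guess `j`. Meaningful if `Tr (ρ₀ M_j) ≠ 0`. -/
noncomputable def confidence (E : Ensemble n d₁ d₂) (M : Fin (n + 1) → BOp d₁ d₂) (j : Fin n) :
    ℝ :=
  E.η j * (E.ρ j * M j.succ).trace.re / (E.avg * M j.succ).trace.re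

/-- The confidences to identify `j` that are attained by all measurements. -/
def confidences (E : Ensemble n d₁ d₂) (j : Fin n) : Set ℝ :=
  {c | ∃ M : Fin (n + 1) → BOp d₁ d₂, IsMeasurement M ∧ (E.avg * M j.succ).trace ≠ 0 ∧
    c = E.confidence M j}

/-- The confidences to identify `j` that are attained by LOCC measurements. -/
def confidencesLOCC (E : Ensemble n d₁ d₂) (j : Fin n) : Set ℝ :=
  {c | ∃ M : Fin (n + 1) → BOp d₁ d₂, IsLOCCMeasurement M ∧ (E.avg * M j.succ).trace ≠ 0 ∧
    c = E.confidence M j}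

/-- The maximum confidence `C_j` of all measurements. -/
noncomputable def C (E : Ensemble n d₁ d₂) (j : Fin n) : ℝ := sSup (E.confidences j)

/-- The optimal confidence of LOCC measurements, `L_j`. It is a supremum: if `ρ₀` is singular, it
need not be attained by a single LOCC measurement. -/
noncomputable def L (E : Ensemble n d₁ d₂) (j : Fin n) : ℝ := sSup (E.confidencesLOCC j)

/-- The set `R_j` of the reals `q` for which `q ρ₀ - η_j ρ_j` is block positive. -/
def R (E : Ensemble n d₁ d₂) (j : Fin n) : Set ℝ :=
  {q | q • E.avg - E.η j • E.ρ j ∈ BlockPositive d₁ d₂}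

/-- `Q_j`, the least element of `R_j`. -/
noncomputable def Q (E : Ensemble n d₁ d₂) (j : Fin n) : ℝ := sInf (E.R j)

/-! The suprema and the infimum above are taken over nonempty bounded sets; the infimum is a
minimum. -/

theorem trace_mul_nonneg {κ : Type} [Fintype κ] {A B : Matrix κ κ ℂ} (hA : A.PosSemidef)
    (hB : B.PosSemidef) : 0 ≤ (A * B).trace := by
  obtain ⟨m, v, rfl⟩ := Matrix.posSemidef_iff_eq_sum_vecMulVec.mp hA
  rw [Finset.sum_mul, Matrix.trace_sum]
  refine Finset.sum_nonneg fun i _ => ?_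
  rw [Matrix.trace_mul_comm, Matrix.mul_vecMulVec, Matrix.trace_vecMulVec, dotProduct_comm]
  exact hB.dotProduct_mulVec_nonneg (v i)

theorem mem_SEP_one (d₁ d₂ : ℕ) (h₁ : 0 < d₁) (h₂ : 0 < d₂) : (1 : BOp d₁ d₂) ∈ SEP d₁ d₂ := by
  have key : ∀ d : ℕ, 0 < d → IsState (((d : ℝ)⁻¹) • (1 : Matrix (Fin d) (Fin d) ℂ)) := by
    intro d hd
    have hd' : (d : ℂ) ≠ 0 := by exact_mod_cast hd.ne'
    refine ⟨Matrix.PosSemidef.one.smul (by positivity), ?_⟩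
    rw [Matrix.trace_smul, Matrix.trace_one, Fintype.card_fin, Complex.real_smul]
    push_cast
    exact inv_mul_cancel₀ hd'
  refine ⟨1, fun _ => d₁ * d₂, fun _ => _, fun _ => _, fun _ => by positivity,
    fun _ => key d₁ h₁, fun _ => key d₂ h₂, ?_⟩
  have h₁' : (d₁ : ℝ) ≠ 0 := by exact_mod_cast h₁.ne'
  have h₂' : (d₂ : ℝ) ≠ 0 := by exact_mod_cast h₂.ne'
  rw [Fin.sum_univ_one, Matrix.smul_kronecker, Matrix.kronecker_smul, Matrix.one_kronecker_one,
    smul_smul, smul_smul]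
  have : (d₁ : ℝ) * d₂ * ((d₁ : ℝ)⁻¹ * (d₂ : ℝ)⁻¹) = 1 := by field_simp
  rw [← mul_assoc] at this
  rw [this, one_smul]

theorem posSemidef_of_mem_SEP {d₁ d₂ : ℕ} {F : BOp d₁ d₂} (hF : F ∈ SEP d₁ d₂) :
    F.PosSemidef := by
  obtain ⟨K, p, σ, τ, hp, hσ, hτ, rfl⟩ := hF
  exact Matrix.posSemidef_sum _ fun l _ => ((hσ l).1.kronecker (hτ l).1).smul (hp l)

theorem avg_isState (E : Ensemble n d₁ d₂) : IsState E.avg := by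
  refine ⟨Matrix.posSemidef_sum _ fun i _ => (E.isState i).1.smul (E.η_pos i).le, ?_⟩
  rw [avg, Matrix.trace_sum]
  have : ∀ i, (E.η i • E.ρ i).trace = ((E.η i : ℝ) : ℂ) := fun i => by
    rw [Matrix.trace_smul, (E.isState i).2, Complex.real_smul, mul_one]
  simp_rw [this]
  exact_mod_cast E.η_sum

theorem avg_sub_posSemidef (E : Ensemble n d₁ d₂) (j : Fin n) :
    (E.avg - E.η j • E.ρ j).PosSemidef := by
  have : E.avg - E.η j • E.ρ j = ∑ i ∈ Finset.univ.erase j, E.η i • E.ρ i := by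
    rw [avg, ← Finset.add_sum_erase _ _ (Finset.mem_univ j), add_sub_cancel_left]
  rw [this]
  exact Matrix.posSemidef_sum _ fun i _ => (E.isState i).1.smul (E.η_pos i).le

theorem isMeasurement_announce (i : Fin (n + 1)) :
    IsMeasurement (fun i' : Fin (n + 1) => if i' = i then (1 : BOp d₁ d₂) else 0) := by
  refine ⟨fun i' => ?_, by simp⟩
  dsimp only
  split_ifs
  · exact Matrix.PosSemidef.one
  · exact Matrix.PosSemidef.zero

theorem confidencesLOCC_subset (E : Ensemble n d₁ d₂) (j : Fin n) :
    E.confidencesLOCC j ⊆ E.confidences j := by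
  rintro c ⟨M, hM, h⟩
  exact ⟨M, hM.1, h⟩

theorem confidencesLOCC_nonempty (E : Ensemble n d₁ d₂) (j : Fin n) :
    (E.confidencesLOCC j).Nonempty := by
  refine ⟨_, _, ⟨isMeasurement_announce j.succ, IsLOCC.announce d₁ d₂ j.succ⟩, ?_, rfl⟩
  simp [E.avg_isState.2]

theorem confidences_nonempty (E : Ensemble n d₁ d₂) (j : Fin n) :
    (E.confidences j).Nonempty :=
  (E.confidencesLOCC_nonempty j).mono (E.confidencesLOCC_subset j)

theorem confidences_bddAbove (E : Ensemble n d₁ d₂) (j : Fin n) :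
    BddAbove (E.confidences j) := by
  refine ⟨1, ?_⟩
  rintro c ⟨M, hM, -, rfl⟩
  have h0 := (Complex.le_def.mp (trace_mul_nonneg E.avg_isState.1 (hM.1 j.succ))).1
  have h1 := (Complex.le_def.mp (trace_mul_nonneg (E.avg_sub_posSemidef j) (hM.1 j.succ))).1
  rw [sub_mul, Matrix.trace_sub, Matrix.smul_mul, Matrix.trace_smul, Complex.sub_re,
    Complex.smul_re, smul_eq_mul] at h1
  simp only [Complex.zero_re] at h0 h1
  exact div_le_one_of_le₀ (by linarith) h0

theorem confidencesLOCC_bddAbove (E : Ensemble n d₁ d₂) (j : Fin n) :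
    BddAbove (E.confidencesLOCC j) :=
  (E.confidences_bddAbove j).mono (E.confidencesLOCC_subset j)

theorem Q_isLeast (E : Ensemble n d₁ d₂) (h₁ : 0 < d₁) (h₂ : 0 < d₂) (j : Fin n) :
    IsLeast (E.R j) (E.Q j) := by
  have hherm : ∀ q : ℝ, (q • E.avg - E.η j • E.ρ j).IsHermitian := fun q =>
    (E.avg_isState.1.isHermitian.smul (IsSelfAdjoint.all q)).sub
      ((E.isState j).1.isHermitian.smul (IsSelfAdjoint.all _))
  have hre : ∀ (q : ℝ) (F : BOp d₁ d₂), ((q • E.avg - E.η j • E.ρ j) * F).trace.re =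
      q * (E.avg * F).trace.re - E.η j * (E.ρ j * F).trace.re := fun q F => by
    rw [sub_mul, Matrix.trace_sub, Matrix.smul_mul, Matrix.smul_mul, Matrix.trace_smul,
      Matrix.trace_smul, Complex.sub_re, Complex.smul_re, Complex.smul_re, smul_eq_mul,
      smul_eq_mul]
  have hR : E.R j = ⋂ F ∈ SEP d₁ d₂,
      {q : ℝ | 0 ≤ q * (E.avg * F).trace.re - E.η j * (E.ρ j * F).trace.re} := by
    ext q
    simp only [R, BlockPositive, Set.mem_ofPred_eq, Set.mem_iInter, hre]
    exact ⟨fun h => h.2, fun h => ⟨hherm q, h⟩⟩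
  have hclosed : IsClosed (E.R j) := by
    rw [hR]
    refine isClosed_biInter fun F _ => isClosed_le continuous_const (by fun_prop)
  have hne : (E.R j).Nonempty := by
    refine ⟨1, hherm 1, fun F hF => ?_⟩
    rw [one_smul]
    exact (Complex.le_def.mp (trace_mul_nonneg (E.avg_sub_posSemidef j)
      (posSemidef_of_mem_SEP hF))).1
  have hbdd : BddBelow (E.R j) := by
    refine ⟨E.η j, fun q hq => ?_⟩
    have := hq.2 1 (mem_SEP_one d₁ d₂ h₁ h₂)
    rw [hre, mul_one, mul_one, E.avg_isState.2, (E.isState j).2, Complex.one_re] at this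
    linarith
  exact ⟨hclosed.csInf_mem hne hbdd, fun q hq => csInf_le hbdd hq⟩

end Ensemble

end Confidence

/-! Write W_q = q ρ₀ − η_j ρ_j. A positive F with Tr(W_q F) < 0 rescales to an effect whose
confidence exceeds q, and conversely, so q < C_j means that W_q fails to be positive
(`lt_C_of_trace_neg`, `exists_trace_neg_of_lt_C`). At q = Q_j, compactness of the product states
makes W_q vanish on one of them (`exists_isState_trace_eq_zero`), which gives weak optimality. For
the converse, Tr(W_q σ) = 0 with σ separable forces q ≤ Q_j once Tr(ρ₀σ) > 0. If that trace were
zero, ρ₀ would have a kernel vector, which W_q inherits. The two-qubit fact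
`BlockPositive.posSemidef_of_mulVec_eq_zero` then makes W_q positive: shifting φ along the kernel
vector ψ leaves the quadratic form unchanged, and generically reaches a product vector because the
determinant of a ψ + φ has a root in a. This contradicts the witness property. The same fact settles
singular ρ₀: product effects are LOCC, so W_q is block positive at q = L_j (`L_mem_R`), hence
positive, hence C_j ≤ L_j. -/

namespace Confidence

open Matrix

/-! ### Positive-semidefinite matrices and compactness of the state space. -/

section Generic

variable {κ : Type} [Fintype κ]

theorem trace_mul_re_nonneg {A B : Matrix κ κ ℂ} (hA : A.PosSemidef) (hB : B.PosSemidef) :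
    0 ≤ (A * B).trace.re :=
  (Complex.le_def.mp (Ensemble.trace_mul_nonneg hA hB)).1

theorem trace_mul_im_eq_zero {A B : Matrix κ κ ℂ} (hA : A.IsHermitian) (hB : B.IsHermitian) :
    (A * B).trace.im = 0 := by
  have h : star (A * B).trace = (A * B).trace := by
    rw [← trace_conjTranspose, conjTranspose_mul, hA.eq, hB.eq, trace_mul_comm]
  exact Complex.conj_eq_iff_im.mp h

theorem trace_mul_vecMulVec_star (W : Matrix κ κ ℂ) (x : κ → ℂ) :
    (W * vecMulVec x (star x)).trace = star x ⬝ᵥ W *ᵥ x := by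
  rw [mul_vecMulVec, trace_vecMulVec, dotProduct_comm]

theorem posSemidef_of_re_nonneg {W : Matrix κ κ ℂ} (hW : W.IsHermitian)
    (h : ∀ x : κ → ℂ, 0 ≤ (star x ⬝ᵥ W *ᵥ x).re) : W.PosSemidef := by
  refine PosSemidef.of_dotProduct_mulVec_nonneg hW fun x => ?_
  rw [Complex.le_def]
  refine ⟨h x, ?_⟩
  rw [← trace_mul_vecMulVec_star]
  exact (trace_mul_im_eq_zero hW (posSemidef_vecMulVec_self_star x).1).symm

/-- A nonzero positive-semidefinite matrix orthogonal to `ρ` gives a kernel vector of `ρ`. -/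
theorem exists_mulVec_eq_zero_of_trace_mul_eq_zero {ρ σ : Matrix κ κ ℂ} (hρ : ρ.PosSemidef)
    (hσ : σ.PosSemidef) (h0 : σ ≠ 0) (h : (ρ * σ).trace = 0) : ∃ ψ : κ → ℂ, ψ ≠ 0 ∧ ρ *ᵥ ψ = 0 := by
  obtain ⟨m, v, rfl⟩ := posSemidef_iff_eq_sum_vecMulVec.mp hσ
  rw [Finset.mul_sum, trace_sum] at h
  simp_rw [trace_mul_vecMulVec_star] at h
  rw [Finset.sum_eq_zero_iff_of_nonneg fun i _ => hρ.dotProduct_mulVec_nonneg (v i)] at h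
  by_contra! hcon
  refine h0 (Finset.sum_eq_zero fun i hi => ?_)
  by_cases hv : v i = 0
  · simp [hv]
  · exact absurd ((hρ.dotProduct_mulVec_zero_iff (v i)).mp (h i hi)) (hcon _ hv)

variable [DecidableEq κ]

/-- A positive-semidefinite matrix is bounded by its trace. -/
theorem trace_smul_one_sub_posSemidef {A : Matrix κ κ ℂ} (hA : A.PosSemidef) :
    (A.trace.re • (1 : Matrix κ κ ℂ) - A).PosSemidef := by
  set U : Matrix κ κ ℂ := (hA.1.eigenvectorUnitary : Matrix κ κ ℂ) with hU
  have hUU : U * Uᴴ = 1 := Unitary.mul_star_self_of_mem hA.1.eigenvectorUnitary.2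
  have hspec : A = U * diagonal (fun i => (hA.1.eigenvalues i : ℂ)) * Uᴴ := by
    conv_lhs => rw [hA.1.spectral_theorem]
    rfl
  have htr : A.trace.re = ∑ i, hA.1.eigenvalues i := by
    rw [hA.1.trace_eq_sum_eigenvalues]; simp
  have : A.trace.re • (1 : Matrix κ κ ℂ) - A =
      U * diagonal (fun i => ((A.trace.re - hA.1.eigenvalues i : ℝ) : ℂ)) * Uᴴ := by
    have h1 : diagonal (fun i => ((A.trace.re - hA.1.eigenvalues i : ℝ) : ℂ)) =
        A.trace.re • (1 : Matrix κ κ ℂ) - diagonal (fun i => (hA.1.eigenvalues i : ℂ)) := by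
      ext i k
      by_cases h : i = k
      · subst h; simp
      · simp [h]
    rw [h1, mul_sub, sub_mul, ← hspec, mul_smul_comm, smul_mul_assoc, mul_one, hUU]
  rw [this]
  refine PosSemidef.mul_mul_conjTranspose_same (PosSemidef.diagonal fun i => ?_) U
  have : hA.1.eigenvalues i ≤ A.trace.re := by
    rw [htr]
    exact Finset.single_le_sum (fun k _ => hA.eigenvalues_nonneg k) (Finset.mem_univ i)
  exact Complex.zero_le_real.mpr (sub_nonneg.mpr this)

theorem IsState.one_sub_posSemidef {σ : Matrix κ κ ℂ} (hσ : IsState σ) :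
    (1 - σ).PosSemidef := by
  simpa [hσ.2] using trace_smul_one_sub_posSemidef hσ.1

theorem IsState.trace_mul_re_le_one {ρ σ : Matrix κ κ ℂ} (hρ : IsState ρ) (hσ : IsState σ) :
    (ρ * σ).trace.re ≤ 1 := by
  have h := trace_mul_re_nonneg hρ.1 hσ.one_sub_posSemidef
  rw [mul_sub, mul_one, trace_sub, hρ.2, Complex.sub_re, Complex.one_re] at h
  linarith

/-- The squared moduli of all entries add up to the purity Tr σ², which is at most one. -/
theorem IsState.norm_apply_le_one {σ : Matrix κ κ ℂ} (hσ : IsState σ) (i k : κ) :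
    ‖σ i k‖ ≤ 1 := by
  have h := hσ.trace_mul_re_le_one hσ
  have h2 : (σ * σ).trace.re = ∑ a, ∑ b, ‖σ a b‖ ^ 2 := by
    -- Turning only the second factor into σᴴ exhibits the trace as a sum of squared moduli.
    conv_lhs => enter [1, 1, 2]; rw [← hσ.1.1.eq]
    simp only [trace, diag_apply, mul_apply, conjTranspose_apply, Complex.re_sum]
    refine Finset.sum_congr rfl fun a _ => Finset.sum_congr rfl fun b _ => ?_
    rw [Complex.star_def, Complex.mul_conj, Complex.normSq_eq_norm_sq, Complex.ofReal_re]
  have h3 : ‖σ i k‖ ^ 2 ≤ ∑ a, ∑ b, ‖σ a b‖ ^ 2 :=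
    (Finset.single_le_sum (f := fun b => ‖σ i b‖ ^ 2) (fun b _ => by positivity)
      (Finset.mem_univ k)).trans
      (Finset.single_le_sum (f := fun a => ∑ b, ‖σ a b‖ ^ 2) (fun a _ => by positivity)
        (Finset.mem_univ i))
  nlinarith [norm_nonneg (σ i k)]

theorem isCompact_setOf_isState : IsCompact {σ : Matrix κ κ ℂ | IsState σ} := by
  have hK : IsCompact (Set.univ.pi fun _ : κ => Set.univ.pi fun _ : κ =>
      Metric.closedBall (0 : ℂ) 1) :=
    isCompact_univ_pi fun _ => isCompact_univ_pi fun _ => isCompact_closedBall _ _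
  refine IsCompact.of_isClosed_subset (X := κ → κ → ℂ) hK ?_ ?_
  · have : {σ : Matrix κ κ ℂ | IsState σ} =
        ({σ | σᴴ = σ} ∩ ⋂ x : κ → ℂ, {σ | 0 ≤ star x ⬝ᵥ σ *ᵥ x}) ∩ {σ | σ.trace = 1} := by
      ext σ
      simp only [IsState, posSemidef_iff_dotProduct_mulVec, Set.mem_inter_iff, Set.mem_iInter,
        Set.mem_ofPred_eq, IsHermitian]
    rw [this]
    refine IsClosed.inter (IsClosed.inter ?_ (isClosed_iInter fun x => ?_)) ?_
    · exact isClosed_eq (f := fun σ : Matrix κ κ ℂ => σᴴ) (by fun_prop) continuous_id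
    · exact isClosed_le (g := fun σ : Matrix κ κ ℂ => star x ⬝ᵥ σ *ᵥ x) continuous_const
        (by fun_prop)
    · exact isClosed_eq (f := fun σ : Matrix κ κ ℂ => σ.trace) (by fun_prop) continuous_const
  · intro σ hσ i _ k _
    simpa using IsState.norm_apply_le_one hσ i k

end Generic

/-! ### The separable cone and block positivity. -/

theorem smul_mem_SEP {d₁ d₂ : ℕ} {F : BOp d₁ d₂} (hF : F ∈ SEP d₁ d₂) {c : ℝ} (hc : 0 ≤ c) :
    c • F ∈ SEP d₁ d₂ := by
  obtain ⟨K, p, σ, τ, hp, hσ, hτ, rfl⟩ := hF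
  exact ⟨K, fun l => c * p l, σ, τ, fun l => mul_nonneg hc (hp l), hσ, hτ, by
    simp_rw [Finset.smul_sum, smul_smul]⟩

theorem kronecker_mem_SEP_of_isState {d₁ d₂ : ℕ} {σ : Matrix (Fin d₁) (Fin d₁) ℂ}
    {τ : Matrix (Fin d₂) (Fin d₂) ℂ} (hσ : IsState σ) (hτ : IsState τ) :
    σ ⊗ₖ τ ∈ SEP d₁ d₂ :=
  ⟨1, fun _ => 1, fun _ => σ, fun _ => τ, fun _ => zero_le_one, fun _ => hσ, fun _ => hτ, by simp⟩

theorem IsState.kronecker {κ κ' : Type} [Fintype κ] [Fintype κ'] {σ : Matrix κ κ ℂ}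
    {τ : Matrix κ' κ' ℂ} (hσ : IsState σ) (hτ : IsState τ) : IsState (σ ⊗ₖ τ) :=
  ⟨hσ.1.kronecker hτ.1, by rw [trace_kronecker, hσ.2, hτ.2, one_mul]⟩

theorem exists_eq_smul_isState {κ : Type} [Fintype κ] {A : Matrix κ κ ℂ} (hA : A.PosSemidef)
    (h0 : A ≠ 0) : ∃ (c : ℝ) (σ : Matrix κ κ ℂ), 0 < c ∧ IsState σ ∧ A = c • σ := by
  have ht := hA.trace_nonneg
  have hne : A.trace ≠ 0 := fun h => h0 (hA.trace_eq_zero_iff.mp h)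
  have htr : A.trace = (A.trace.re : ℂ) := Complex.ext rfl (by
    rw [← (Complex.nonneg_iff.mp ht).2, Complex.ofReal_im])
  have hpos : 0 < A.trace.re := lt_of_le_of_ne (Complex.nonneg_iff.mp ht).1 fun h => hne (by
    rw [htr, ← h, Complex.ofReal_zero])
  refine ⟨A.trace.re, A.trace.re⁻¹ • A, hpos, ⟨hA.smul (by positivity), ?_⟩, ?_⟩
  · rw [trace_smul, Complex.real_smul, Complex.ofReal_inv, ← htr, inv_mul_cancel₀ hne]
  · rw [smul_smul, mul_inv_cancel₀ hpos.ne', one_smul]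

theorem zero_mem_SEP (d₁ d₂ : ℕ) : (0 : BOp d₁ d₂) ∈ SEP d₁ d₂ :=
  ⟨0, Fin.elim0, Fin.elim0, Fin.elim0, fun l => l.elim0, fun l => l.elim0, fun l => l.elim0,
    by simp⟩

theorem kronecker_mem_SEP {d₁ d₂ : ℕ} {A : Matrix (Fin d₁) (Fin d₁) ℂ}
    {B : Matrix (Fin d₂) (Fin d₂) ℂ} (hA : A.PosSemidef) (hB : B.PosSemidef) :
    A ⊗ₖ B ∈ SEP d₁ d₂ := by
  by_cases hA0 : A = 0
  · rw [hA0, zero_kronecker]; exact zero_mem_SEP _ _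
  by_cases hB0 : B = 0
  · rw [hB0, kronecker_zero]; exact zero_mem_SEP _ _
  obtain ⟨a, σ, ha, hσ, rfl⟩ := exists_eq_smul_isState hA hA0
  obtain ⟨b, τ, hb, hτ, rfl⟩ := exists_eq_smul_isState hB hB0
  rw [smul_kronecker, kronecker_smul]
  exact smul_mem_SEP (smul_mem_SEP (kronecker_mem_SEP_of_isState hσ hτ) hb.le) ha.le

/-- Block positivity has to be tested on product states only. -/
theorem mem_BlockPositive_of_isState {d₁ d₂ : ℕ} {W : BOp d₁ d₂} (hW : W.IsHermitian)
    (h : ∀ σ τ, IsState σ → IsState τ → 0 ≤ (W * (σ ⊗ₖ τ)).trace.re) :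
    W ∈ BlockPositive d₁ d₂ := by
  refine ⟨hW, ?_⟩
  rintro F ⟨K, p, σ, τ, hp, hσ, hτ, rfl⟩
  rw [Finset.mul_sum, trace_sum, Complex.re_sum]
  refine Finset.sum_nonneg fun l _ => ?_
  rw [mul_smul_comm, trace_smul, Complex.smul_re, smul_eq_mul]
  exact mul_nonneg (hp l) (h _ _ (hσ l) (hτ l))

theorem BlockPositive.product_nonneg {d₁ d₂ : ℕ} {W : BOp d₁ d₂} (hW : W ∈ BlockPositive d₁ d₂)
    (u : Fin d₁ → ℂ) (v : Fin d₂ → ℂ) :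
    0 ≤ (star (fun p : Fin d₁ × Fin d₂ => u p.1 * v p.2) ⬝ᵥ
      W *ᵥ (fun p : Fin d₁ × Fin d₂ => u p.1 * v p.2)).re := by
  have h := hW.2 _ (kronecker_mem_SEP (posSemidef_vecMulVec_self_star u)
    (posSemidef_vecMulVec_self_star v))
  have e : vecMulVec u (star u) ⊗ₖ vecMulVec v (star v) =
      vecMulVec (fun p : Fin d₁ × Fin d₂ => u p.1 * v p.2)
        (star (fun p : Fin d₁ × Fin d₂ => u p.1 * v p.2)) := by
    ext p q
    simp [kroneckerMap_apply, vecMulVec_apply]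
    ring
  rwa [e, trace_mul_vecMulVec_star] at h

/-! ### Two-qubit product vectors and singular block-positive operators. -/

/-- A two-qubit vector of zero determinant is a product vector. -/
theorem exists_product_of_det_eq_zero {x : Fin 2 × Fin 2 → ℂ}
    (h : x (0, 0) * x (1, 1) = x (0, 1) * x (1, 0)) :
    ∃ u v : Fin 2 → ℂ, x = fun p => u p.1 * v p.2 := by
  by_cases h0 : x (0, 0) = 0
  · rw [h0, zero_mul, eq_comm, mul_eq_zero] at h
    rcases h with h | h
    · refine ⟨![0, 1], ![x (1, 0), x (1, 1)], funext fun ⟨i, k⟩ => ?_⟩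
      fin_cases i <;> fin_cases k <;> simp [h0, h]
    · refine ⟨![x (0, 1), x (1, 1)], ![0, 1], funext fun ⟨i, k⟩ => ?_⟩
      fin_cases i <;> fin_cases k <;> simp [h0, h]
  · refine ⟨![x (0, 0), x (1, 0)], ![1, x (0, 1) / x (0, 0)], funext fun ⟨i, k⟩ => ?_⟩
    fin_cases i <;> fin_cases k <;> simp
    · field_simp
    · field_simp
      linear_combination h

/-- A line of two-qubit vectors contains a product vector, up to a genericity condition if its
direction is a product vector itself. -/
theorem exists_product_smul_add {ψ φ : Fin 2 × Fin 2 → ℂ}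
    (h : ψ (0, 0) * φ (1, 1) + ψ (1, 1) * φ (0, 0) - ψ (0, 1) * φ (1, 0) - ψ (1, 0) * φ (0, 1) ≠ 0) :
    ∃ (a : ℂ) (u v : Fin 2 → ℂ), a • ψ + φ = fun p => u p.1 * v p.2 := by
  set c := ψ (0, 0) * φ (1, 1) + ψ (1, 1) * φ (0, 0) - ψ (0, 1) * φ (1, 0) - ψ (1, 0) * φ (0, 1)
    with hc
  set D := ψ (0, 0) * ψ (1, 1) - ψ (0, 1) * ψ (1, 0) with hD
  set D' := φ (0, 0) * φ (1, 1) - φ (0, 1) * φ (1, 0) with hD'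
  -- The left side is the determinant of a ψ + φ as a polynomial in a. If ψ is itself a product
  -- vector it is linear, and c ≠ 0 supplies the root.
  have key : ∃ a : ℂ, D * (a * a) + c * a + D' = 0 := by
    by_cases hD0 : D = 0
    · refine ⟨-D' / c, ?_⟩
      rw [hD0]
      field_simp
      ring
    · obtain ⟨s, hs⟩ := IsAlgClosed.exists_pow_nat_eq (discrim D c D') two_pos
      exact exists_quadratic_eq_zero hD0 ⟨s, by rw [← hs, sq]⟩
  obtain ⟨a, ha⟩ := key
  refine ⟨a, exists_product_of_det_eq_zero ?_⟩
  simp only [Pi.add_apply, Pi.smul_apply, smul_eq_mul]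
  linear_combination ha + a * hc + (a * a) * hD + hD'

/-- A singular block-positive operator of two qubits is positive semidefinite. -/
theorem BlockPositive.posSemidef_of_mulVec_eq_zero {W : BOp 2 2} (hW : W ∈ BlockPositive 2 2)
    {ψ : Fin 2 × Fin 2 → ℂ} (hψ : ψ ≠ 0) (hWψ : W *ᵥ ψ = 0) : W.PosSemidef := by
  refine posSemidef_of_re_nonneg hW.1 ?_
  have hψW : star ψ ᵥ* W = 0 := by
    rw [← hW.1.eq, ← star_mulVec, hWψ, star_zero]
  have generic : ∀ φ : Fin 2 × Fin 2 → ℂ, ψ (0, 0) * φ (1, 1) + ψ (1, 1) * φ (0, 0)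
      - ψ (0, 1) * φ (1, 0) - ψ (1, 0) * φ (0, 1) ≠ 0 → 0 ≤ (star φ ⬝ᵥ W *ᵥ φ).re := by
    intro φ hφ
    obtain ⟨a, u, v, h⟩ := exists_product_smul_add hφ
    have hn := BlockPositive.product_nonneg hW u v
    -- Since W kills ψ from both sides, the form takes the same value at a ψ + φ as at φ.
    rwa [← h, mulVec_add, mulVec_smul, hWψ, smul_zero, zero_add, star_add, add_dotProduct,
      star_smul, smul_dotProduct, dotProduct_mulVec, hψW, zero_dotProduct, smul_zero,
      zero_add] at hn
  intro φ
  by_cases hφ : ψ (0, 0) * φ (1, 1) + ψ (1, 1) * φ (0, 0)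
      - ψ (0, 1) * φ (1, 0) - ψ (1, 0) * φ (0, 1) = 0
  swap
  · exact generic φ hφ
  -- Up to sign, χ is the spin flip of ψ, chosen so that its polarized determinant with ψ is ‖ψ‖² ≠
  -- 0. Thus φ + t χ is generic for every t ≠ 0, and letting t → 0 handles the exceptional φ.
  let χ : Fin 2 × Fin 2 → ℂ := fun p =>
    (if p.1 = p.2 then 1 else -1) * star (ψ (1 - p.1, 1 - p.2))
  have hχ : ψ (0, 0) * χ (1, 1) + ψ (1, 1) * χ (0, 0)
      - ψ (0, 1) * χ (1, 0) - ψ (1, 0) * χ (0, 1) = ψ ⬝ᵥ star ψ := by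
    simp [χ, dotProduct, Fintype.sum_prod_type]
    ring
  have hcont : Continuous fun t : ℝ => (star (φ + (t : ℂ) • χ) ⬝ᵥ W *ᵥ (φ + (t : ℂ) • χ)).re := by
    fun_prop
  have hlim : Filter.Tendsto (fun t : ℝ => (star (φ + (t : ℂ) • χ) ⬝ᵥ W *ᵥ (φ + (t : ℂ) • χ)).re)
      (nhdsWithin 0 {0}ᶜ) (nhds (star φ ⬝ᵥ W *ᵥ φ).re) := by
    have := (hcont.tendsto 0).mono_left (nhdsWithin_le_nhds (s := {0}ᶜ))
    simpa using this
  refine ge_of_tendsto hlim (eventually_nhdsWithin_of_forall fun t ht => generic _ ?_)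
  have : (t : ℂ) * (ψ ⬝ᵥ star ψ) ≠ 0 :=
    mul_ne_zero (by exact_mod_cast ht) (by rwa [Ne, dotProduct_self_star_eq_zero])
  convert this using 1
  rw [← hχ]
  simp only [Pi.add_apply, Pi.smul_apply, smul_eq_mul]
  linear_combination hφ

open scoped MatrixOrder Matrix.Norms.L2Operator in
theorem exists_eq_conjTranspose_mul_self {κ : Type} [Fintype κ] [DecidableEq κ]
    {A : Matrix κ κ ℂ} (hA : A.PosSemidef) : ∃ B : Matrix κ κ ℂ, A = Bᴴ * B :=
  CStarAlgebra.nonneg_iff_eq_star_mul_self.mp hA.nonneg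

/-! ### LOCC protocols. -/

section LOCC

variable {ι : Type} [DecidableEq ι]

/-- Induction on the protocol tree: after result k the effects sum to AₖᴴAₖ ⊗ 1 (or its mirror
image), and completeness of the Kraus operators adds these up to the identity. -/
theorem IsLOCC.isMeasurement [Fintype ι] {d₁ d₂ : ℕ} {M : ι → BOp d₁ d₂} (hM : IsLOCC d₁ d₂ M) :
    IsMeasurement M := by
  induction hM with
  | announce d₁ d₂ i =>
    refine ⟨fun i' => ?_, by simp⟩
    dsimp only
    split_ifs
    · exact PosSemidef.one
    · exact PosSemidef.zero
  | first d₁ d₂ K d A hA N hN ih =>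
    refine ⟨fun i => posSemidef_sum _ fun k _ => ((ih k).1 i).conjTranspose_mul_mul_same _, ?_⟩
    rw [Finset.sum_comm]
    have h : ∀ k, ∑ i, (A k ⊗ₖ (1 : Matrix (Fin d₂) (Fin d₂) ℂ))ᴴ * N k i *
        (A k ⊗ₖ (1 : Matrix (Fin d₂) (Fin d₂) ℂ)) = ((A k)ᴴ * A k) ⊗ₖ (1 : Matrix (Fin d₂) (Fin d₂) ℂ) := fun k => by
      rw [← Matrix.sum_mul, ← Matrix.mul_sum, (ih k).2, Matrix.mul_one, conjTranspose_kronecker,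
        ← mul_kronecker_mul, conjTranspose_one, Matrix.mul_one]
    rw [Finset.sum_congr rfl fun k _ => h k, ← one_kronecker_one, ← hA]
    ext p q
    simp [Matrix.sum_apply, kroneckerMap_apply, Finset.sum_mul]
  | second d₁ d₂ K d B hB N hN ih =>
    refine ⟨fun i => posSemidef_sum _ fun k _ => ((ih k).1 i).conjTranspose_mul_mul_same _, ?_⟩
    rw [Finset.sum_comm]
    have h : ∀ k, ∑ i, ((1 : Matrix (Fin d₁) (Fin d₁) ℂ) ⊗ₖ B k)ᴴ * N k i *
        ((1 : Matrix (Fin d₁) (Fin d₁) ℂ) ⊗ₖ B k) = (1 : Matrix (Fin d₁) (Fin d₁) ℂ) ⊗ₖ ((B k)ᴴ * B k) := fun k => by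
      rw [← Matrix.sum_mul, ← Matrix.mul_sum, (ih k).2, Matrix.mul_one, conjTranspose_kronecker,
        ← mul_kronecker_mul, conjTranspose_one, Matrix.mul_one]
    rw [Finset.sum_congr rfl fun k _ => h k, ← one_kronecker_one, ← hB]
    ext p q
    simp [Matrix.sum_apply, kroneckerMap_apply, Finset.mul_sum]

/-- Product effects are realized by local measurements with one-way communication. -/
theorem exists_isLOCC_eq_kronecker {d₁ d₂ : ℕ} {σ : Matrix (Fin d₁) (Fin d₁) ℂ}
    {τ : Matrix (Fin d₂) (Fin d₂) ℂ} (hσ : σ.PosSemidef) (hσ' : (1 - σ).PosSemidef)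
    (hτ : τ.PosSemidef) (hτ' : (1 - τ).PosSemidef) {i o : ι} (hio : i ≠ o) :
    ∃ M : ι → BOp d₁ d₂, IsLOCC d₁ d₂ M ∧ M i = σ ⊗ₖ τ := by
  obtain ⟨A, hA⟩ := exists_eq_conjTranspose_mul_self hσ
  obtain ⟨A', hA'⟩ := exists_eq_conjTranspose_mul_self hσ'
  obtain ⟨B, hB⟩ := exists_eq_conjTranspose_mul_self hτ
  obtain ⟨B', hB'⟩ := exists_eq_conjTranspose_mul_self hτ'
  -- The second party announces `i` on the result B and `o` on B'. The first party hands over on A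
  -- and announces `o` at once on A', so `i` arises only from A and B together.
  have second := IsLOCC.second (ι := ι) d₁ d₂ 2 (fun _ => d₂) ![B, B']
    (by simp [Fin.sum_univ_two, ← hB, ← hB'])
    (fun k i' => if i' = ![i, o] k then 1 else 0) (fun k => IsLOCC.announce d₁ d₂ _)
  have first := IsLOCC.first (ι := ι) d₁ d₂ 2 (fun _ => d₁) ![A, A']
    (by simp [Fin.sum_univ_two, ← hA, ← hA'])
    ![_, fun i' => if i' = o then 1 else 0]
    (Fin.forall_fin_two.mpr ⟨second, IsLOCC.announce d₁ d₂ o⟩)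
  refine ⟨_, first, ?_⟩
  simp [Fin.sum_univ_two, hio, conjTranspose_kronecker, ← mul_kronecker_mul, hA, hB]

end LOCC

/-! ### Confidences and the operators q ρ₀ − η_j ρ_j. -/

namespace Ensemble

section General

variable {n d₁ d₂ : ℕ}

theorem isHermitian_smul_avg_sub (E : Ensemble n d₁ d₂) (j : Fin n) (q : ℝ) :
    (q • E.avg - E.η j • E.ρ j).IsHermitian :=
  (E.avg_isState.1.isHermitian.smul (IsSelfAdjoint.all q)).sub
    ((E.isState j).1.isHermitian.smul (IsSelfAdjoint.all _))

theorem re_trace_smul_avg_sub_mul (E : Ensemble n d₁ d₂) (j : Fin n) (q : ℝ) (F : BOp d₁ d₂) :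
    ((q • E.avg - E.η j • E.ρ j) * F).trace.re =
      q * (E.avg * F).trace.re - E.η j * (E.ρ j * F).trace.re := by
  rw [sub_mul, trace_sub, smul_mul, smul_mul, trace_smul, trace_smul, Complex.sub_re,
    Complex.smul_re, Complex.smul_re, smul_eq_mul, smul_eq_mul]

theorem re_trace_mul_le (E : Ensemble n d₁ d₂) (j : Fin n) {F : BOp d₁ d₂} (hF : F.PosSemidef) :
    E.η j * (E.ρ j * F).trace.re ≤ (E.avg * F).trace.re := by
  have h := trace_mul_re_nonneg (E.avg_sub_posSemidef j) hF
  have h1 := E.re_trace_smul_avg_sub_mul j 1 F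
  rw [one_smul, one_mul] at h1
  linarith

theorem trace_avg_mul_ne_zero_iff (E : Ensemble n d₁ d₂) {F : BOp d₁ d₂} (hF : F.PosSemidef) :
    (E.avg * F).trace ≠ 0 ↔ 0 < (E.avg * F).trace.re := by
  refine ⟨fun h => lt_of_le_of_ne (trace_mul_re_nonneg E.avg_isState.1 hF) fun h0 => h ?_,
    fun h h0 => by simp [h0] at h⟩
  exact Complex.ext h0.symm (trace_mul_im_eq_zero E.avg_isState.1.1 hF.1)

/-- Kernel vectors of the average state are kernel vectors of all its components. -/
theorem smul_avg_sub_mulVec_eq_zero (E : Ensemble n d₁ d₂) (j : Fin n) (q : ℝ)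
    {ψ : Fin d₁ × Fin d₂ → ℂ} (h : E.avg *ᵥ ψ = 0) : (q • E.avg - E.η j • E.ρ j) *ᵥ ψ = 0 := by
  have h1 := (E.avg_sub_posSemidef j).dotProduct_mulVec_nonneg ψ
  have hpsd : (E.η j • E.ρ j).PosSemidef := (E.isState j).1.smul (E.η_pos j).le
  rw [sub_mulVec, h, zero_sub, dotProduct_neg, Left.nonneg_neg_iff] at h1
  -- As ρ₀ dominates η_j ρ_j, the form of the latter at ψ is at most 0, hence equal to 0.
  have h2 := (hpsd.dotProduct_mulVec_zero_iff ψ).mp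
    (le_antisymm h1 (hpsd.dotProduct_mulVec_nonneg ψ))
  rw [sub_mulVec, smul_mulVec, h, smul_zero, h2, sub_zero]

theorem C_le_of_posSemidef (E : Ensemble n d₁ d₂) (j : Fin n) {q : ℝ}
    (h : (q • E.avg - E.η j • E.ρ j).PosSemidef) : E.C j ≤ q := by
  refine csSup_le (E.confidences_nonempty j) ?_
  rintro c ⟨M, hM, hne, rfl⟩
  have h1 := trace_mul_re_nonneg h (hM.1 j.succ)
  rw [re_trace_smul_avg_sub_mul] at h1
  rw [confidence, div_le_iff₀ ((E.trace_avg_mul_ne_zero_iff (hM.1 _)).mp hne)]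
  linarith

/-- Normalizing F to a state σ makes it an effect, since σ ≤ 1. The measurement with σ as guess j
and 1 − σ as inconclusive outcome then has confidence above q. -/
theorem lt_C_of_trace_neg (E : Ensemble n d₁ d₂) (j : Fin n) {q : ℝ} {F : BOp d₁ d₂}
    (hF : F.PosSemidef) (h : ((q • E.avg - E.η j • E.ρ j) * F).trace.re < 0) : q < E.C j := by
  have hF0 : F ≠ 0 := by rintro rfl; simp at h
  obtain ⟨c, σ, hc, hσ, rfl⟩ := exists_eq_smul_isState hF hF0
  rw [mul_smul_comm, trace_smul, Complex.smul_re, smul_eq_mul, mul_neg_iff] at h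
  replace h : ((q • E.avg - E.η j • E.ρ j) * σ).trace.re < 0 := by
    rcases h with h | h
    · exact h.2
    · exact absurd h.1 hc.not_gt
  rw [re_trace_smul_avg_sub_mul] at h
  have hle := E.re_trace_mul_le j hσ.1
  have hnn := mul_nonneg (E.η_pos j).le (trace_mul_re_nonneg (E.isState j).1 hσ.1)
  -- If Tr(ρ₀σ) vanished, η_j Tr(ρ_jσ) ≤ Tr(ρ₀σ) would leave no room for a negative value.
  have hpos : 0 < (E.avg * σ).trace.re := by
    refine lt_of_le_of_ne (trace_mul_re_nonneg E.avg_isState.1 hσ.1) fun h0 => ?_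
    rw [← h0, mul_zero] at h
    linarith
  let M : Fin (n + 1) → BOp d₁ d₂ := Fin.cons (1 - σ) fun i => if i = j then σ else 0
  have hMj : M j.succ = σ := by simp [M]
  have hM : IsMeasurement M := by
    constructor
    · refine Fin.cases ?_ fun i => ?_
      · exact hσ.one_sub_posSemidef
      · simp only [M, Fin.cons_succ]
        split_ifs
        · exact hσ.1
        · exact PosSemidef.zero
    · simp [M, Fin.sum_univ_succ]
  refine lt_of_lt_of_le ?_ (le_csSup (E.confidences_bddAbove j)
    ⟨M, hM, by rw [hMj]; exact (E.trace_avg_mul_ne_zero_iff hσ.1).mpr hpos, rfl⟩)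
  rw [confidence, hMj, lt_div_iff₀ hpos]
  linarith

theorem exists_trace_neg_of_lt_C (E : Ensemble n d₁ d₂) (j : Fin n) {q : ℝ} (h : q < E.C j) :
    ∃ F : BOp d₁ d₂, F.PosSemidef ∧ ((q • E.avg - E.η j • E.ρ j) * F).trace.re < 0 := by
  obtain ⟨c, ⟨M, hM, hne, rfl⟩, hq⟩ := exists_lt_of_lt_csSup (E.confidences_nonempty j) h
  refine ⟨M j.succ, hM.1 _, ?_⟩
  rw [confidence, lt_div_iff₀ ((E.trace_avg_mul_ne_zero_iff (hM.1 _)).mp hne)] at hq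
  rw [re_trace_smul_avg_sub_mul]
  linarith

theorem L_le_C (E : Ensemble n d₁ d₂) (j : Fin n) : E.L j ≤ E.C j :=
  csSup_le_csSup (E.confidences_bddAbove j) (E.confidencesLOCC_nonempty j)
    (E.confidencesLOCC_subset j)

/-- The local confidence bounds the confidences of product effects. -/
theorem L_mem_R (E : Ensemble n d₁ d₂) (j : Fin n) : E.L j ∈ E.R j := by
  refine mem_BlockPositive_of_isState (E.isHermitian_smul_avg_sub j _) fun σ τ hσ hτ => ?_
  have hst := (hσ.kronecker hτ).1
  rw [re_trace_smul_avg_sub_mul]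
  have hle := E.re_trace_mul_le j hst
  -- If ρ₀ gives the effect zero weight, so does ρ_j; otherwise the effect belongs to an LOCC
  -- measurement, whose confidence is at most L_j.
  rcases (trace_mul_re_nonneg E.avg_isState.1 hst).eq_or_lt with h0 | hpos
  · rw [← h0] at hle ⊢
    linarith
  · obtain ⟨M, hM, hMj⟩ := exists_isLOCC_eq_kronecker hσ.1 hσ.one_sub_posSemidef hτ.1
      hτ.one_sub_posSemidef (Fin.succ_ne_zero j)
    have := le_csSup (E.confidencesLOCC_bddAbove j)
      ⟨M, ⟨hM.isMeasurement, hM⟩, by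
        rw [hMj]; exact (E.trace_avg_mul_ne_zero_iff hst).mpr hpos, rfl⟩
    rw [confidence, hMj, div_le_iff₀ hpos] at this
    exact sub_nonneg.mpr this

/-- The operator at the least `q` vanishes on some product state. -/
theorem exists_isState_trace_eq_zero (E : Ensemble n d₁ d₂) (h₁ : 0 < d₁) (h₂ : 0 < d₂)
    (j : Fin n) : ∃ σ τ, IsState σ ∧ IsState τ ∧
      ((σ ⊗ₖ τ) * (E.Q j • E.avg - E.η j • E.ρ j)).trace = 0 := by
  have hQ := E.Q_isLeast h₁ h₂ j
  have hne : ∀ d : ℕ, 0 < d → {σ : Matrix (Fin d) (Fin d) ℂ | IsState σ}.Nonempty := by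
    intro d hd
    have : Nonempty (Fin d) := ⟨⟨0, hd⟩⟩
    obtain ⟨c, σ, -, hσ, -⟩ := exists_eq_smul_isState
      (PosSemidef.one (n := Fin d) (R := ℂ)) one_ne_zero
    exact ⟨σ, hσ⟩
  have hcont : Continuous fun x : Matrix (Fin d₁) (Fin d₁) ℂ × Matrix (Fin d₂) (Fin d₂) ℂ =>
      ((E.Q j • E.avg - E.η j • E.ρ j) * (x.1 ⊗ₖ x.2)).trace.re := by
    refine Complex.continuous_re.comp (Continuous.matrix_trace (continuous_const.matrix_mul ?_))
    exact continuous_matrix fun p q => by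
      simp only [kroneckerMap_apply]
      fun_prop
  obtain ⟨⟨σ, τ⟩, ⟨hσ, hτ⟩, hmin⟩ := (isCompact_setOf_isState.prod
    isCompact_setOf_isState).exists_isMinOn ((hne d₁ h₁).prod (hne d₂ h₂)) hcont.continuousOn
  refine ⟨σ, τ, hσ, hτ, ?_⟩
  rw [trace_mul_comm]
  refine Complex.ext (le_antisymm ?_ (hQ.1.2 _ (kronecker_mem_SEP_of_isState hσ hτ)))
    (trace_mul_im_eq_zero (E.isHermitian_smul_avg_sub j _) (hσ.kronecker hτ).1.1)
  by_contra! hpos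
  set m := ((E.Q j • E.avg - E.η j • E.ρ j) * (σ ⊗ₖ τ)).trace.re with hm
  -- If the minimum m over product states were positive, lowering q by m would cost at most m
  -- Tr(ρ₀(σ' ⊗ τ')) ≤ m and keep block positivity, against leastness of Q_j.
  have : E.Q j - m ∈ E.R j := by
    refine mem_BlockPositive_of_isState (E.isHermitian_smul_avg_sub j _) fun σ' τ' hσ' hτ' => ?_
    have h1 : m ≤ _ := hmin (Set.mk_mem_prod hσ' hτ')
    have h2 := E.avg_isState.trace_mul_re_le_one (hσ'.kronecker hτ')
    simp only [re_trace_smul_avg_sub_mul] at h1 ⊢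
    rw [Complex.zero_re] at hpos
    nlinarith
  have := hQ.2 this
  rw [Complex.zero_re] at hpos
  linarith

end General

theorem posSemidef_of_mem_R {n : ℕ} (E : Ensemble n 2 2) (j : Fin n) {q : ℝ} (hq : q ∈ E.R j)
    {ψ : Fin 2 × Fin 2 → ℂ} (hψ : ψ ≠ 0) (h : E.avg *ᵥ ψ = 0) :
    (q • E.avg - E.η j • E.ρ j).PosSemidef :=
  BlockPositive.posSemidef_of_mulVec_eq_zero hq hψ (E.smul_avg_sub_mulVec_eq_zero j q h)

end Ensemble

end Confidence

/-! ### The criterion and the singular case. -/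

open Confidence in
theorem corollary1 {n : ℕ} (E : Confidence.Ensemble n 2 2) (j : Fin n) :
    (∀ q : ℝ, (E.Q j = q ∧ q < E.C j) ↔
      Confidence.IsWeaklyOptimalEW (q • E.avg - E.η j • E.ρ j)) ∧
    (E.avg.rank < 4 → E.L j = E.C j) := by
  have hQ := E.Q_isLeast two_pos two_pos j
  refine ⟨fun q => ⟨?_, ?_⟩, fun hrank => ?_⟩
  · rintro ⟨rfl, hC⟩
    obtain ⟨F, hF, hneg⟩ := E.exists_trace_neg_of_lt_C j hC
    obtain ⟨σ, τ, hσ, hτ, h0⟩ := E.exists_isState_trace_eq_zero two_pos two_pos j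
    exact ⟨⟨hQ.1.1, hQ.1.2, F, hF, fun hsep => (hQ.1.2 F hsep).not_gt hneg, hneg⟩, _,
      kronecker_mem_SEP_of_isState hσ hτ, hσ.kronecker hτ, h0⟩
  · rintro ⟨⟨hherm, hblock, F, hF, -, hneg⟩, σ, hsep, hσ, h0⟩
    have hqR : q ∈ E.R j := ⟨hherm, hblock⟩
    refine ⟨le_antisymm (hQ.2 hqR) ?_, E.lt_C_of_trace_neg j hF hneg⟩
    have hpos : 0 < (E.avg * σ).trace.re := by
      -- This is where the two-qubit dimension enters: Tr(ρ₀σ) = 0 would give ρ₀ a kernel vector and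
      -- make the witness positive semidefinite.
      refine (E.trace_avg_mul_ne_zero_iff hσ.1).mp fun htr => ?_
      have hσ0 : σ ≠ 0 := by
        rintro rfl
        simpa using hσ.2
      obtain ⟨ψ, hψ, hker⟩ :=
        exists_mulVec_eq_zero_of_trace_mul_eq_zero E.avg_isState.1 hσ.1 hσ0 htr
      exact (trace_mul_re_nonneg (E.posSemidef_of_mem_R j hqR hψ hker) hF).not_gt hneg
    have h1 := hQ.1.2 σ hsep
    rw [Matrix.trace_mul_comm] at h0
    have h2 := congrArg Complex.re h0
    rw [E.re_trace_smul_avg_sub_mul] at h1 h2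
    rw [Complex.zero_re] at h2
    -- At σ the operator for Q_j is nonnegative and the one for q vanishes; their difference is (Q_j
    -- − q) Tr(ρ₀σ).
    exact le_of_mul_le_mul_right (by linarith) hpos
  · have hdet : E.avg.det = 0 := by
      by_contra hdet
      have := Matrix.rank_of_isUnit E.avg
        ((Matrix.isUnit_iff_isUnit_det _).mpr (isUnit_iff_ne_zero.mpr hdet))
      rw [this] at hrank
      simp at hrank
    obtain ⟨ψ, hψ, hker⟩ := Matrix.exists_mulVec_eq_zero_iff.mpr hdet
    exact le_antisymm (E.L_le_C j)
      (E.C_le_of_posSemidef j (E.posSemidef_of_mem_R j (E.L_mem_R j) hψ hker))
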